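/- Let $X,Y$ be (real or complex) Banach spaces, let $A:D(A)\subset X\to X$ and $D:D(D)\subset Y\to Y$ generate $C_0$-semigroups $(e^{tA})_{t\ge0}$ on $X$ and $(e^{tD})_{t\ge0}$ on $Y$, and let $C:X\to Y$ be a bounded linear operator. Put $$R(t)x:=\int_0^t e^{(t-s)D}Ce^{sA}x\,ds\qquad (t\ge 0,\ x\in X),\qquad \mathbf A:=\begin{pmatrix}A&0\\ C&D\end{pmatrix},\quad D(\mathbf A):=D(A)\times D(D)\subset X\times Y .$$ A semigroup $(T(t))_{t\ge 0}$ is called uniformly exponentially stable if there are $M\geq 0$, $\omega>0$ with $\|T(t)\|\le Me^{-\omega t}$ for all $t\ge0$. A continuous function on $[0,\infty)$ is called asymptotically almost periodic if it is the sum of the restriction to $[0,\infty)$ of a (Bohr) almost periodic function on $\mathbb R$ and a function tending to $0$ at infinity. Assume that $(e^{tD})_{t\ge0}$ is uniformly exponentially stable. Then the following hold. 1. If for some $x\in X$ the orbit $(e^{tA}x)_{t\ge0}$ is bounded, then $(R(t)x)_{t\ge0}$ is bounded. 2. If for some $x\in X$ the orbit $(e^{tA}x)_{t\ge0}$ is asymptotically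 almost periodic, then $(R(t)x)_{t\ge0}$ is asymptotically almost periodic. 3. The operator $D$ has a bounded inverse $D^{-1}:Y\to D(D)\subset Y$, and if for some $x\in X$ the limit $\lim_{t\to\infty}e^{tA}x$ exists, then $\lim_{t\to\infty}R(t)x$ exists and $$\lim_{t\to\infty}R(t)x=-D^{-1}C\lim_{t\to\infty}e^{tA}x .$$ 4. If $(e^{tA})_{t\ge0}$ is uniformly exponentially stable, then $\mathbf A$ generates a $C_0$-semigroup $(e^{t\mathbf A})_{t\ge0}$ on $X\times Y$, and it is uniformly exponentially stable. -/

import Mathlib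

open Filter Topology Set

/-- `T` (used at times `t ≥ 0` only) is a `C₀`-semigroup of bounded operators on `E`, and the
unbounded operator `A` is exactly its infinitesimal generator: `x` lies in the domain of `A` with
`A x = y` if and only if `(T h x - x) / h → y` as `h ↓ 0`. -/
structure GeneratesC0Semigroup {𝕜 E : Type*} [RCLike 𝕜] [NormedAddCommGroup E] [NormedSpace 𝕜 E]
    (A : E →ₗ.[𝕜] E) (T : ℝ → E →L[𝕜] E) : Prop where
  map_zero : T 0 = ContinuousLinearMap.id 𝕜 E
  map_add : ∀ s t : ℝ, 0 ≤ s → 0 ≤ t → T (s + t) = (T s).comp (T t)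
  continuousOn : ∀ x : E, ContinuousOn (fun t : ℝ => T t x) (Ici 0)
  mem_graph_iff : ∀ x y : E, (x, y) ∈ A.graph ↔
    Tendsto (fun h : ℝ => ((h : 𝕜)⁻¹) • (T h x - x)) (𝓝[>] 0) (𝓝 y)

/-- Uniform exponential stability of a one-parameter semigroup. -/
def UniformlyExpStable {𝕜 E : Type*} [RCLike 𝕜] [NormedAddCommGroup E] [NormedSpace 𝕜 E]
    (T : ℝ → E →L[𝕜] E) : Prop :=
  ∃ M ω : ℝ, 0 < ω ∧ ∀ t : ℝ, 0 ≤ t → ‖T t‖ ≤ M * Real.exp (-ω * t)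

/-- A function `[0, ∞) → E` (given on `ℝ`, only its values at `t ≥ 0` matter) is bounded. -/
def BoundedOrbit {E : Type*} [NormedAddCommGroup E] (f : ℝ → E) : Prop :=
  Bornology.IsBounded (f '' Ici 0)

/-- Almost periodicity on the real line in the sense of Bohr: `g` is continuous and for each
`ε > 0` the set of `ε`-almost periods of `g` is relatively dense. -/
def BohrAlmostPeriodic {E : Type*} [NormedAddCommGroup E] (g : ℝ → E) : Prop :=
  Continuous g ∧ ∀ ε : ℝ, 0 < ε → ∃ L : ℝ, 0 < L ∧
    ∀ a : ℝ, ∃ τ ∈ Icc a (a + L), ∀ t : ℝ, ‖g (t + τ) - g t‖ ≤ ε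

/-- Asymptotic almost periodicity of a function `[0, ∞) → E` (only values at `t ≥ 0` matter): it is
continuous, and the sum of the restriction to `[0, ∞)` of an almost periodic function and a
function that tends to `0` at infinity. -/
def AsymptoticallyAlmostPeriodic {E : Type*} [NormedAddCommGroup E] (f : ℝ → E) : Prop :=
  ContinuousOn f (Ici 0) ∧
    ∃ g : ℝ → E, BohrAlmostPeriodic g ∧ Tendsto (fun t => f t - g t) atTop (𝓝 0)

/-- The bounded operator `G` is the (everywhere defined, two-sided) inverse of the unbounded
operator `D`. -/
def IsBoundedInverse {𝕜 E : Type*} [RCLike 𝕜] [NormedAddCommGroup E] [NormedSpace 𝕜 E]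
    (D : E →ₗ.[𝕜] E) (G : E →L[𝕜] E) : Prop :=
  (∀ y : E, ∃ h : G y ∈ D.domain, D ⟨G y, h⟩ = y) ∧ ∀ y : D.domain, G (D y) = y

/-- The operator matrix with rows `(A, B)` and `(C, D)`, with diagonal domain `D(A) × D(D)`, for
bounded off-diagonal entries: `(x, y) ↦ (A x + B y, C x + D y)`. -/
def operatorMatrix {𝕜 X Y : Type*} [RCLike 𝕜] [NormedAddCommGroup X] [NormedSpace 𝕜 X]
    [NormedAddCommGroup Y] [NormedSpace 𝕜 Y]
    (A : X →ₗ.[𝕜] X) (B : Y →L[𝕜] X) (C : X →L[𝕜] Y) (D : Y →ₗ.[𝕜] Y) :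
    (X × Y) →ₗ.[𝕜] (X × Y) where
  domain := A.domain.prod D.domain
  toFun :=
    { toFun := fun z =>
        (A ⟨z.1.1, z.2.1⟩ + B z.1.2, C z.1.1 + D ⟨z.1.2, z.2.2⟩)
      map_add' := by
        rintro ⟨⟨x, y⟩, hx, hy⟩ ⟨⟨x', y'⟩, hx', hy'⟩
        have h1 := A.map_add ⟨x, hx⟩ ⟨x', hx'⟩
        have h2 := D.map_add ⟨y, hy⟩ ⟨y', hy'⟩
        refine Prod.ext ?_ ?_
        · change A (⟨x, hx⟩ + ⟨x', hx'⟩) + B (y + y') = (A ⟨x, hx⟩ + B y) + (A ⟨x', hx'⟩ + B y')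
          rw [h1, map_add]; abel
        · change C (x + x') + D (⟨y, hy⟩ + ⟨y', hy'⟩) = (C x + D ⟨y, hy⟩) + (C x' + D ⟨y', hy'⟩)
          rw [h2, map_add]; abel
      map_smul' := by
        rintro c ⟨⟨x, y⟩, hx, hy⟩
        have h1 := A.map_smul c ⟨x, hx⟩
        have h2 := D.map_smul c ⟨y, hy⟩
        refine Prod.ext ?_ ?_
        · change A (c • ⟨x, hx⟩) + B (c • y) = c • (A ⟨x, hx⟩ + B y)
          rw [h1, map_smul, smul_add]
        · change C (c • x) + D (c • ⟨y, hy⟩) = c • (C x + D ⟨y, hy⟩)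
          rw [h2, map_smul, smul_add] }

/-- `R(t) x = ∫₀ᵗ e^{(t-s)D} C e^{sA} x ds`, where `S t = e^{tA}` and `T t = e^{tD}`. -/
noncomputable def convR {𝕜 X Y : Type*} [RCLike 𝕜] [NormedAddCommGroup X] [NormedSpace 𝕜 X]
    [NormedAddCommGroup Y] [NormedSpace 𝕜 Y] [NormedSpace ℝ Y]
    (S : ℝ → X →L[𝕜] X) (C : X →L[𝕜] Y) (T : ℝ → Y →L[𝕜] Y) (t : ℝ) (x : X) : Y :=
  ∫ s in (0 : ℝ)..t, T (t - s) (C (S s x))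

/-!
Substituting `u = t - s` turns `R(t) x` into the convolution `∫₀^∞ T(u) φ(t - u) du` of the stable
semigroup `T` with the orbit `φ = C S(·) x` extended by `0` to the negative half-line
(`convR_eq_semigroupConv`). The norm of `T` is integrable on `(0, ∞)`, so this convolution is bounded
in the supremum norm (`UniformlyExpStable.exists_norm_integral_le`), and dominated convergence
(`tendsto_semigroupConv`) lets every pointwise limit pass under the integral.

Bounded orbits are then immediate. An almost period of `g` is one of its convolution with a
constant factor lost, so the convolution of an almost periodic function is almost periodic; if
`S(·) x - g` tends to `0`, then `R(·) x` differs from the convolution of `C g` by the convolution of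
a bounded function vanishing at infinity, which itself vanishes at infinity. If `S(t) x` converges
to `x'`, then `R(t) x` converges to `∫₀^∞ T(u) C x' du`, and the operator `y ↦ ∫₀^∞ T(u) y du` is the
negative of the inverse of the generator (`GeneratesC0Semigroup.exists_isBoundedInverse`): the
difference quotients of `T` at it are minus the means of `T(u) y` over `[0, h]`.

For the operator matrix, the family with rows `(S(t), 0)` and `(R(t), T(t))` is a semigroup by the
cocycle identity `convR_add`. Since `R(h) x / h → C x`, its generator is the operator matrix, and the
convolution of two decaying exponentials decays exponentially
(`exists_generatesC0Semigroup_operatorMatrix`). Any other semigroup with the same generator agrees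
with this one for nonnegative times (`GeneratesC0Semigroup.unique`).
-/

/-! ### Strongly continuous families that are bounded -/

section StrongContinuity

open MeasureTheory

variable {𝕜 E F : Type*} [RCLike 𝕜] [NormedAddCommGroup E] [NormedSpace 𝕜 E]
  [NormedAddCommGroup F] [NormedSpace 𝕜 F]

/-- A bounded strongly continuous family on `[0, ∞)`, extended to negative times by its value at
`0`, is jointly continuous in time and vector. -/
theorem continuous_apply_max_zero {T : ℝ → E →L[𝕜] F}
    (hc : ∀ y, ContinuousOn (fun t => T t y) (Ici 0)) {M : ℝ} (hM : ∀ t, 0 ≤ t → ‖T t‖ ≤ M) :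
    Continuous (fun p : ℝ × E => T (max p.1 0) p.2) := by
  have h : Continuous (fun p : E × ℝ => T (max p.2 0) p.1) := by
    refine continuous_prod_of_continuous_lipschitzWith _ M.toNNReal (fun y => ?_) fun t => ?_
    · exact (hc y).comp_continuous (continuous_id.max continuous_const)
        fun t => mem_Ici.2 (le_max_right _ _)
    · refine (T (max t 0)).lipschitz.weaken ?_
      rw [← NNReal.coe_le_coe]
      exact (hM _ (le_max_right _ _)).trans (Real.le_coe_toNNReal M)
  exact h.comp continuous_swap

/-- A function continuous on `[0, ∞)` that is bounded near infinity is bounded on `[0, ∞)`. -/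
theorem ContinuousOn.exists_norm_le_of_eventually_le {f : ℝ → E} (hf : ContinuousOn f (Ici 0))
    {K : ℝ} (hK : ∀ᶠ t in atTop, ‖f t‖ ≤ K) : ∃ K', ∀ t, 0 ≤ t → ‖f t‖ ≤ K' := by
  obtain ⟨a, ha⟩ := eventually_atTop.1 hK
  obtain ⟨K₁, hK₁⟩ := (isCompact_Icc (a := (0 : ℝ)) (b := a)).exists_bound_of_continuousOn
    (hf.mono Icc_subset_Ici_self)
  refine ⟨max K K₁, fun t ht => ?_⟩
  rcases le_total a t with h | h
  · exact (ha t h).trans (le_max_left _ _)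
  · exact (hK₁ t ⟨ht, h⟩).trans (le_max_right _ _)

theorem UniformlyExpStable.exists_bound {T : ℝ → E →L[𝕜] E} (hT : UniformlyExpStable T) :
    ∃ M ω : ℝ, 0 ≤ M ∧ 0 < ω ∧ ∀ t : ℝ, 0 ≤ t → ‖T t‖ ≤ M * Real.exp (-ω * t) := by
  obtain ⟨M, ω, hω, h⟩ := hT
  refine ⟨M, ω, ?_, hω, h⟩
  have := (norm_nonneg _).trans (h 0 le_rfl)
  simpa using this

theorem UniformlyExpStable.exists_norm_le {T : ℝ → E →L[𝕜] E} (hT : UniformlyExpStable T) :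
    ∃ M : ℝ, ∀ t : ℝ, 0 ≤ t → ‖T t‖ ≤ M := by
  obtain ⟨M, ω, hM, hω, h⟩ := hT.exists_bound
  refine ⟨M, fun t ht => (h t ht).trans (mul_le_of_le_one_right hM ?_)⟩
  rw [Real.exp_le_one_iff]
  nlinarith

end StrongContinuity

/-! ### Convolution of a stable semigroup with a bounded function -/

section Convolution

open MeasureTheory

variable {𝕜 Y : Type*} [RCLike 𝕜] [NormedAddCommGroup Y] [NormedSpace 𝕜 Y]
  {T : ℝ → Y →L[𝕜] Y} {φ : ℝ → Y} {K : ℝ}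

theorem BohrAlmostPeriodic.exists_norm_le {g : ℝ → Y} (hg : BohrAlmostPeriodic g) :
    ∃ K, ∀ t, ‖g t‖ ≤ K := by
  obtain ⟨L, -, h⟩ := hg.2 1 one_pos
  obtain ⟨K, hK⟩ := (isCompact_Icc (a := (0 : ℝ)) (b := L)).exists_bound_of_continuousOn
    hg.1.continuousOn
  refine ⟨K + 1, fun t => ?_⟩
  -- an almost period in `[-t, -t + L]` moves `t` into `[0, L]`
  obtain ⟨τ, ⟨h1, h2⟩, hτ⟩ := h (-t)
  have h3 := hK (t + τ) ⟨by linarith, by linarith⟩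
  have h4 := norm_sub_norm_le (g t) (g (t + τ))
  have h5 := hτ t
  rw [norm_sub_rev] at h5
  linarith

theorem BohrAlmostPeriodic.continuousLinearMap_comp {X : Type*} [NormedAddCommGroup X]
    [NormedSpace 𝕜 X] {g : ℝ → X} (hg : BohrAlmostPeriodic g) (C : X →L[𝕜] Y) :
    BohrAlmostPeriodic (fun t => C (g t)) := by
  refine ⟨C.continuous.comp hg.1, fun ε hε => ?_⟩
  obtain ⟨L, hL, h⟩ := hg.2 (ε / (‖C‖ + 1)) (by positivity)
  refine ⟨L, hL, fun a => ?_⟩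
  obtain ⟨τ, hτ, hgτ⟩ := h a
  refine ⟨τ, hτ, fun t => ?_⟩
  rw [← map_sub]
  refine (C.le_opNorm_of_le (hgτ t)).trans ?_
  rw [mul_div_assoc', div_le_iff₀ (by positivity)]
  nlinarith [norm_nonneg C]

theorem aestronglyMeasurable_semigroup_apply (hc : ∀ y, ContinuousOn (fun t => T t y) (Ici 0))
    (hT : UniformlyExpStable T) (hφ : StronglyMeasurable φ) :
    AEStronglyMeasurable (fun u => T u (φ u)) (volume.restrict (Ioi 0)) := by
  obtain ⟨M, hM⟩ := hT.exists_norm_le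
  have h : StronglyMeasurable (fun u : ℝ => T (max u 0) (φ u)) :=
    (continuous_apply_max_zero hc hM).comp_stronglyMeasurable
      (stronglyMeasurable_id.prodMk hφ)
  refine h.aestronglyMeasurable.congr ?_
  filter_upwards [ae_restrict_mem measurableSet_Ioi] with u hu
  rw [max_eq_left (le_of_lt hu)]

/-- One integrable function dominates all the integrands `T(u) φ(u)`, up to the bound of `φ`. -/
theorem UniformlyExpStable.exists_integrableOn_bound (hT : UniformlyExpStable T) :
    ∃ b : ℝ → ℝ, IntegrableOn b (Ioi 0) ∧ (∀ u, 0 ≤ b u) ∧ ∀ u ∈ Ioi (0 : ℝ), ‖T u‖ ≤ b u := by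
  obtain ⟨M, ω, hM, hω, h⟩ := hT.exists_bound
  exact ⟨fun u => M * Real.exp (-ω * u), (exp_neg_integrableOn_Ioi 0 hω).const_mul M,
    fun u => by positivity, fun u hu => h u (le_of_lt hu)⟩

theorem integrableOn_semigroup_apply (hc : ∀ y, ContinuousOn (fun t => T t y) (Ici 0))
    (hT : UniformlyExpStable T) (hφ : StronglyMeasurable φ) (hK : ∀ s, ‖φ s‖ ≤ K) :
    IntegrableOn (fun u => T u (φ u)) (Ioi 0) := by
  obtain ⟨b, hb, hb0, hTb⟩ := hT.exists_integrableOn_bound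
  refine Integrable.mono' (hb.mul_const K) (aestronglyMeasurable_semigroup_apply hc hT hφ) ?_
  filter_upwards [ae_restrict_mem measurableSet_Ioi] with u hu
  exact ((T u).le_opNorm _).trans (mul_le_mul (hTb u hu) (hK u) (norm_nonneg _) (hb0 u))

variable [NormedSpace ℝ Y]

/-- The convolution `t ↦ ∫₀^∞ T(u) φ(t - u) du` of an operator family on `[0, ∞)` with a function
on the whole line. -/
noncomputable def semigroupConv (T : ℝ → Y →L[𝕜] Y) (φ : ℝ → Y) (t : ℝ) : Y :=
  ∫ u in Ioi (0 : ℝ), T u (φ (t - u))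

/-- The map `φ ↦ ∫₀^∞ T(u) φ(u) du` is bounded in the supremum norm. -/
theorem UniformlyExpStable.exists_norm_integral_le (hT : UniformlyExpStable T) :
    ∃ c : ℝ, 0 ≤ c ∧ ∀ (φ : ℝ → Y) (K : ℝ), (∀ s, ‖φ s‖ ≤ K) →
      ‖∫ u in Ioi (0 : ℝ), T u (φ u)‖ ≤ c * K := by
  obtain ⟨b, hb, hb0, hTb⟩ := hT.exists_integrableOn_bound
  refine ⟨∫ u in Ioi (0 : ℝ), b u, integral_nonneg hb0, fun φ K hK => ?_⟩
  rw [← integral_mul_const]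
  refine norm_integral_le_of_norm_le (hb.mul_const K) ?_
  filter_upwards [ae_restrict_mem measurableSet_Ioi] with u hu
  exact ((T u).le_opNorm _).trans (mul_le_mul (hTb u hu) (hK u) (norm_nonneg _) (hb0 u))

/-- Dominated convergence for the convolution; it yields both its continuity in time and its
behaviour at infinity. -/
theorem tendsto_semigroupConv (hc : ∀ y, ContinuousOn (fun t => T t y) (Ici 0))
    (hT : UniformlyExpStable T) (hφ : StronglyMeasurable φ) (hK : ∀ s, ‖φ s‖ ≤ K)
    {l : Filter ℝ} [l.IsCountablyGenerated] {ψ : ℝ → Y}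
    (h : ∀ᵐ u, Tendsto (fun t => φ (t - u)) l (𝓝 (ψ u))) :
    Tendsto (semigroupConv T φ) l (𝓝 (∫ u in Ioi (0 : ℝ), T u (ψ u))) := by
  obtain ⟨b, hb, hb0, hTb⟩ := hT.exists_integrableOn_bound
  refine tendsto_integral_filter_of_dominated_convergence (fun u => b u * K)
    (Eventually.of_forall fun t => ?_) (Eventually.of_forall fun t => ?_) (hb.mul_const K) ?_
  · exact aestronglyMeasurable_semigroup_apply hc hT
      (hφ.comp_measurable (measurable_const.sub measurable_id))
  · filter_upwards [ae_restrict_mem measurableSet_Ioi] with u hu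
    exact ((T u).le_opNorm _).trans (mul_le_mul (hTb u hu) (hK _) (norm_nonneg _) (hb0 u))
  · filter_upwards [ae_restrict_of_ae h] with u hu
    exact ((T u).continuous.tendsto _).comp hu

/-- A jump of `φ` at the origin does not affect the continuity of the convolution. -/
theorem continuous_semigroupConv (hc : ∀ y, ContinuousOn (fun t => T t y) (Ici 0))
    (hT : UniformlyExpStable T) (hφ : StronglyMeasurable φ) (hK : ∀ s, ‖φ s‖ ≤ K)
    (hφc : ∀ s, s ≠ 0 → ContinuousAt φ s) : Continuous (semigroupConv T φ) := by
  refine continuous_iff_continuousAt.2 fun t => tendsto_semigroupConv hc hT hφ hK ?_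
  have h0 : ∀ᵐ u : ℝ, u ≠ t := by simp [ae_iff]
  filter_upwards [h0] with u hu
  have h : ContinuousAt (fun s : ℝ => φ (s - u)) t :=
    ContinuousAt.comp (f := fun s : ℝ => s - u) (hφc (t - u) (sub_ne_zero.2 hu.symm))
      (continuous_sub_right u).continuousAt
  exact h

/-- Almost periods of `g` are, up to a constant factor, almost periods of its convolution. -/
theorem BohrAlmostPeriodic.semigroupConv {g : ℝ → Y}
    (hc : ∀ y, ContinuousOn (fun t => T t y) (Ici 0)) (hT : UniformlyExpStable T)
    (hg : BohrAlmostPeriodic g) : BohrAlmostPeriodic (semigroupConv T g) := by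
  obtain ⟨K, hK⟩ := hg.exists_norm_le
  have hgm := hg.1.stronglyMeasurable
  refine ⟨continuous_semigroupConv hc hT hgm hK fun s _ => hg.1.continuousAt, fun ε hε => ?_⟩
  obtain ⟨c, hc0, hcb⟩ := hT.exists_norm_integral_le
  obtain ⟨L, hL, h⟩ := hg.2 (ε / (c + 1)) (by positivity)
  refine ⟨L, hL, fun a => ?_⟩
  obtain ⟨τ, hτ, hgτ⟩ := h a
  refine ⟨τ, hτ, fun t => ?_⟩
  have hi : ∀ t, IntegrableOn (fun u => T u (g (t - u))) (Ioi 0) := fun t =>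
    integrableOn_semigroup_apply hc hT
      (hgm.comp_measurable (measurable_const.sub measurable_id)) fun s => hK _
  have h1 : _root_.semigroupConv T g (t + τ) - _root_.semigroupConv T g t =
      ∫ u in Ioi (0 : ℝ), T u (g (t + τ - u) - g (t - u)) := by
    simp only [_root_.semigroupConv, map_sub]
    rw [integral_sub (hi _) (hi _)]
  rw [h1]
  have h2 := hcb (fun u => g (t + τ - u) - g (t - u)) (ε / (c + 1)) fun u => by
    have := hgτ (t - u)
    rwa [show t - u + τ = t + τ - u by ring] at this
  refine h2.trans ?_
  rw [mul_div_assoc', div_le_iff₀ (by positivity)]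
  nlinarith

end Convolution

/-! ### The function `R(t) x` as a convolution -/

section ConvR

open MeasureTheory

variable {𝕜 X Y : Type*} [RCLike 𝕜] [NormedAddCommGroup X] [NormedSpace 𝕜 X]
  [NormedAddCommGroup Y] [NormedSpace 𝕜 Y]
  {S : ℝ → X →L[𝕜] X} {C : X →L[𝕜] Y} {T : ℝ → Y →L[𝕜] Y} {x : X} {K : ℝ}

/-- The orbit `C S(·) x` on `[0, ∞)`, extended by `0` to the negative half-line. -/
noncomputable def zeroExtendedOrbit (S : ℝ → X →L[𝕜] X) (C : X →L[𝕜] Y) (x : X) : ℝ → Y :=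
  (Ici (0 : ℝ)).indicator fun s => C (S s x)

theorem zeroExtendedOrbit_of_nonneg {s : ℝ} (hs : 0 ≤ s) :
    zeroExtendedOrbit S C x s = C (S s x) :=
  indicator_of_mem (mem_Ici.2 hs) _

theorem zeroExtendedOrbit_of_neg {s : ℝ} (hs : s < 0) : zeroExtendedOrbit S C x s = 0 :=
  indicator_of_notMem (by simpa using hs) _

theorem stronglyMeasurable_zeroExtendedOrbit (hS : ContinuousOn (fun t => S t x) (Ici 0)) :
    StronglyMeasurable (zeroExtendedOrbit S C x) := by
  have h : Continuous (fun s : ℝ => C (S (max s 0) x)) :=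
    C.continuous.comp (hS.comp_continuous (continuous_id.max continuous_const)
      fun t => mem_Ici.2 (le_max_right _ _))
  have h2 : zeroExtendedOrbit S C x = (Ici (0 : ℝ)).indicator fun s => C (S (max s 0) x) := by
    ext s
    rcases le_or_gt 0 s with hs | hs
    · rw [zeroExtendedOrbit_of_nonneg hs, indicator_of_mem (mem_Ici.2 hs), max_eq_left hs]
    · rw [zeroExtendedOrbit_of_neg hs, indicator_of_notMem (by simpa using hs)]
  rw [h2]
  exact h.stronglyMeasurable.indicator measurableSet_Ici

theorem continuousAt_zeroExtendedOrbit (hS : ContinuousOn (fun t => S t x) (Ici 0)) {s : ℝ}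
    (hs : s ≠ 0) : ContinuousAt (zeroExtendedOrbit S C x) s := by
  rcases lt_or_gt_of_ne hs with h | h
  · refine (continuousAt_const (y := (0 : Y))).congr ?_
    filter_upwards [Iio_mem_nhds h] with r hr
    exact (zeroExtendedOrbit_of_neg hr).symm
  · refine (C.continuous.continuousAt.comp (hS.continuousAt (Ici_mem_nhds h))).congr ?_
    filter_upwards [Ici_mem_nhds h] with r hr
    exact (zeroExtendedOrbit_of_nonneg hr).symm

theorem norm_zeroExtendedOrbit_le (hK : ∀ t, 0 ≤ t → ‖S t x‖ ≤ K) (s : ℝ) :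
    ‖zeroExtendedOrbit S C x s‖ ≤ ‖C‖ * K := by
  have hK0 : 0 ≤ K := (norm_nonneg _).trans (hK 0 le_rfl)
  rcases le_or_gt 0 s with hs | hs
  · rw [zeroExtendedOrbit_of_nonneg hs]
    exact C.le_opNorm_of_le (hK s hs)
  · rw [zeroExtendedOrbit_of_neg hs, norm_zero]
    positivity

variable [NormedSpace ℝ Y]

theorem convR_eq_semigroupConv {t : ℝ} (ht : 0 ≤ t) :
    convR S C T t x = semigroupConv T (zeroExtendedOrbit S C x) t := by
  have h1 := intervalIntegral.integral_comp_sub_left (a := 0) (b := t)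
    (fun u => T u (C (S (t - u) x))) t
  simp only [sub_sub_cancel, sub_self, sub_zero] at h1
  rw [convR, h1, semigroupConv, intervalIntegral.integral_of_le ht]
  rw [setIntegral_eq_of_subset_of_forall_sdiff_eq_zero (s := Ioc 0 t) measurableSet_Ioi
    Ioc_subset_Ioi_self]
  · refine setIntegral_congr_fun measurableSet_Ioc fun u hu => ?_
    rw [zeroExtendedOrbit_of_nonneg (by linarith [hu.2])]
  · intro u hu
    have : t < u := by
      by_contra h
      exact hu.2 ⟨hu.1, not_lt.1 h⟩
    rw [zeroExtendedOrbit_of_neg (by linarith), map_zero]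

theorem continuousOn_convR (hc : ∀ y, ContinuousOn (fun t => T t y) (Ici 0))
    (hT : UniformlyExpStable T) (hS : ContinuousOn (fun t => S t x) (Ici 0))
    (hK : ∀ t, 0 ≤ t → ‖S t x‖ ≤ K) : ContinuousOn (fun t => convR S C T t x) (Ici 0) :=
  (continuous_semigroupConv hc hT (stronglyMeasurable_zeroExtendedOrbit hS)
    (norm_zeroExtendedOrbit_le hK)
    fun _ => continuousAt_zeroExtendedOrbit hS).continuousOn.congr
      fun _ ht => convR_eq_semigroupConv ht

theorem boundedOrbit_convR (hT : UniformlyExpStable T) (hx : BoundedOrbit fun t => S t x) :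
    BoundedOrbit fun t => convR S C T t x := by
  obtain ⟨K, hK⟩ := isBounded_iff_forall_norm_le.1 hx
  obtain ⟨c, -, h⟩ := hT.exists_norm_integral_le
  refine isBounded_iff_forall_norm_le.2 ⟨c * (‖C‖ * K), ?_⟩
  rintro _ ⟨t, ht, rfl⟩
  simp only
  rw [convR_eq_semigroupConv ht]
  exact h _ _ fun s => norm_zeroExtendedOrbit_le (fun r hr => hK _ ⟨r, hr, rfl⟩) _

theorem tendsto_convR (hc : ∀ y, ContinuousOn (fun t => T t y) (Ici 0))
    (hT : UniformlyExpStable T) (hS : ContinuousOn (fun t => S t x) (Ici 0)) {x' : X}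
    (hx : Tendsto (fun t => S t x) atTop (𝓝 x')) :
    Tendsto (fun t => convR S C T t x) atTop (𝓝 (∫ u in Ioi (0 : ℝ), T u (C x'))) := by
  obtain ⟨K, hK⟩ := hS.exists_norm_le_of_eventually_le
    ((hx.norm.eventually (gt_mem_nhds (lt_add_one _))).mono fun _ => le_of_lt)
  refine (tendsto_semigroupConv hc hT (stronglyMeasurable_zeroExtendedOrbit (C := C) hS)
    (norm_zeroExtendedOrbit_le hK) (l := atTop) (ψ := fun _ => C x') ?_).congr' ?_
  · refine Eventually.of_forall fun u => ?_
    have h1 : Tendsto (fun t => C (S (t - u) x)) atTop (𝓝 (C x')) :=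
      (C.continuous.tendsto _).comp (hx.comp (tendsto_atTop_add_const_right _ (-u) tendsto_id))
    refine h1.congr' ?_
    filter_upwards [eventually_ge_atTop u] with t ht
    exact (zeroExtendedOrbit_of_nonneg (by linarith)).symm
  · filter_upwards [eventually_ge_atTop 0] with t ht
    exact (convR_eq_semigroupConv ht).symm

theorem asymptoticallyAlmostPeriodic_convR (hc : ∀ y, ContinuousOn (fun t => T t y) (Ici 0))
    (hT : UniformlyExpStable T) (hx : AsymptoticallyAlmostPeriodic fun t => S t x) :
    AsymptoticallyAlmostPeriodic fun t => convR S C T t x := by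
  obtain ⟨hS, g, hg, hfg⟩ := hx
  have hCg := hg.continuousLinearMap_comp C
  obtain ⟨Kg, hKg⟩ := BohrAlmostPeriodic.exists_norm_le hCg
  obtain ⟨K, hK⟩ : ∃ K, ∀ t, 0 ≤ t → ‖S t x‖ ≤ K := by
    obtain ⟨K₁, hK₁⟩ := (hS.sub hg.1.continuousOn).exists_norm_le_of_eventually_le
      ((hfg.norm.eventually (gt_mem_nhds (lt_add_one _))).mono fun _ => le_of_lt)
    obtain ⟨K₂, hK₂⟩ := hg.exists_norm_le
    refine ⟨K₁ + K₂, fun t ht => ?_⟩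
    have h := norm_add_le (S t x - g t) (g t)
    rw [sub_add_cancel] at h
    exact h.trans (add_le_add (hK₁ t ht) (hK₂ t))
  have hm := stronglyMeasurable_zeroExtendedOrbit (C := C) hS
  have hb := norm_zeroExtendedOrbit_le (C := C) hK
  refine ⟨continuousOn_convR hc hT hS hK, semigroupConv T fun t => C (g t),
    BohrAlmostPeriodic.semigroupConv hc hT hCg, ?_⟩
  -- the difference is the convolution with a bounded function that vanishes at infinity
  have h0 : Tendsto (semigroupConv T fun s => zeroExtendedOrbit S C x s - C (g s)) atTop
      (𝓝 (∫ u in Ioi (0 : ℝ), T u 0)) := by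
    refine tendsto_semigroupConv hc hT (hm.sub hCg.1.stronglyMeasurable)
      (K := ‖C‖ * K + Kg) (fun s => (norm_sub_le _ _).trans (add_le_add (hb s) (hKg s))) ?_
    refine Eventually.of_forall fun u => ?_
    have h1 : Tendsto (fun t => C (S (t - u) x - g (t - u))) atTop (𝓝 (C 0)) :=
      (C.continuous.tendsto _).comp (hfg.comp (tendsto_atTop_add_const_right _ (-u) tendsto_id))
    rw [map_zero] at h1
    refine h1.congr' ?_
    filter_upwards [eventually_ge_atTop u] with t ht
    rw [Pi.sub_apply, zeroExtendedOrbit_of_nonneg (by linarith), map_sub]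
  simp only [map_zero, integral_zero] at h0
  refine h0.congr' ?_
  filter_upwards [eventually_ge_atTop 0] with t ht
  rw [convR_eq_semigroupConv ht]
  simp only [semigroupConv, map_sub]
  exact integral_sub
    (integrableOn_semigroup_apply hc hT
      (hm.comp_measurable (measurable_const.sub measurable_id)) fun s => hb _)
    (integrableOn_semigroup_apply hc hT
      (hCg.1.stronglyMeasurable.comp_measurable (measurable_const.sub measurable_id))
      fun s => hKg _)

end ConvR

/-! ### Semigroups and their generators -/

section Generator

open MeasureTheory

variable {𝕜 E : Type*} [RCLike 𝕜] [NormedAddCommGroup E] [NormedSpace 𝕜 E]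
  {A : E →ₗ.[𝕜] E} {T U V : ℝ → E →L[𝕜] E}

theorem GeneratesC0Semigroup.apply_add (hT : GeneratesC0Semigroup A T) {s t : ℝ} (hs : 0 ≤ s)
    (ht : 0 ≤ t) (x : E) : T (s + t) x = T s (T t x) := by
  rw [hT.map_add s t hs ht, ContinuousLinearMap.comp_apply]

theorem GeneratesC0Semigroup.continuous_orbit (hT : GeneratesC0Semigroup A T) (x : E) :
    Continuous fun t : ℝ => T (max t 0) x :=
  (hT.continuousOn x).comp_continuous (continuous_id.max continuous_const)
    fun _ => mem_Ici.2 (le_max_right _ _)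

/-- A semigroup maps the graph of its generator into itself, acting diagonally. -/
theorem GeneratesC0Semigroup.apply_mem_graph (hT : GeneratesC0Semigroup A T) {x y : E}
    (hxy : (x, y) ∈ A.graph) {t : ℝ} (ht : 0 ≤ t) : (T t x, T t y) ∈ A.graph := by
  rw [hT.mem_graph_iff] at hxy ⊢
  refine (((T t).continuous.tendsto _).comp hxy).congr' ?_
  filter_upwards [self_mem_nhdsWithin] with h hh
  have hh' : (0 : ℝ) ≤ h := le_of_lt hh
  simp only [Function.comp_apply, map_smul, map_sub]
  rw [← hT.apply_add ht hh', add_comm, hT.apply_add hh' ht]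

/-- A semigroup is bounded on compact time intervals, by the uniform boundedness principle. -/
theorem GeneratesC0Semigroup.exists_norm_le_Icc [CompleteSpace E] (hT : GeneratesC0Semigroup A T)
    (t : ℝ) : ∃ M : ℝ, ∀ s ∈ Icc 0 t, ‖T s‖ ≤ M := by
  obtain ⟨M, hM⟩ := banach_steinhaus (g := fun s : Icc (0 : ℝ) t => T s) fun x => by
    obtain ⟨K, hK⟩ := (isCompact_Icc (a := (0 : ℝ)) (b := t)).exists_bound_of_continuousOn
      ((hT.continuousOn x).mono Icc_subset_Ici_self)
    exact ⟨K, fun s => hK s s.2⟩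
  exact ⟨M, fun s hs => hM ⟨s, hs⟩⟩

variable [NormedSpace ℝ E] [IsScalarTower ℝ 𝕜 E]

theorem RCLike.ofReal_inv_smul_eq (𝕜 : Type*) [RCLike 𝕜] [NormedSpace 𝕜 E] [IsScalarTower ℝ 𝕜 E]
    (h : ℝ) (y : E) : ((h : 𝕜)⁻¹) • y = h⁻¹ • y := by
  rw [RCLike.real_smul_eq_coe_smul (K := 𝕜), RCLike.ofReal_inv]

variable [CompleteSpace E]

theorem Continuous.tendsto_inv_smul_integral {f : ℝ → E} (hf : Continuous f) (a : ℝ) :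
    Tendsto (fun h : ℝ => h⁻¹ • ∫ s in a..a + h, f s) (𝓝[>] 0) (𝓝 (f a)) := by
  have h := (hf.integral_hasStrictDerivAt a a).hasDerivAt.tendsto_slope_zero_right
  simpa using h

/-- Integrals of orbits over `[0, t]` lie in the domain of the generator, and the generator maps
them to the increment of the orbit. -/
theorem GeneratesC0Semigroup.integral_mem_graph (hT : GeneratesC0Semigroup A T) (x : E) {t : ℝ}
    (ht : 0 ≤ t) : (∫ s in (0 : ℝ)..t, T (max s 0) x, T t x - x) ∈ A.graph := by
  have hc := hT.continuous_orbit x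
  rw [hT.mem_graph_iff]
  have h1 := (hc.tendsto_inv_smul_integral t).sub (hc.tendsto_inv_smul_integral 0)
  simp only [max_eq_left ht, max_self, hT.map_zero, ContinuousLinearMap.id_apply, zero_add] at h1
  refine h1.congr' ?_
  filter_upwards [self_mem_nhdsWithin] with h hh
  have hh' : (0 : ℝ) ≤ h := le_of_lt hh
  have h2 : T h (∫ s in (0 : ℝ)..t, T (max s 0) x) = ∫ s in h..t + h, T (max s 0) x := by
    rw [← ContinuousLinearMap.intervalIntegral_comp_comm _ (hc.intervalIntegrable _ _)]
    have h3 := intervalIntegral.integral_comp_add_right (a := 0) (b := t)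
      (fun s => T (max s 0) x) h
    rw [zero_add] at h3
    rw [← h3]
    refine intervalIntegral.integral_congr fun s hs => ?_
    rw [uIcc_of_le ht] at hs
    rw [max_eq_left hs.1, max_eq_left (add_nonneg hs.1 hh'), ← hT.apply_add hh' hs.1, add_comm]
  have hi : ∀ a b, IntervalIntegrable (fun s => T (max s 0) x) volume a b := fun a b =>
    hc.intervalIntegrable a b
  rw [RCLike.ofReal_inv_smul_eq, ← smul_sub, h2]
  congr 1
  rw [sub_eq_sub_iff_add_eq_add, add_comm, add_comm (∫ s in h..t + h, _),
    intervalIntegral.integral_add_adjacent_intervals (hi _ _) (hi _ _),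
    intervalIntegral.integral_add_adjacent_intervals (hi _ _) (hi _ _)]

/-- A generator determines its semigroup: on the domain, `s ↦ U(t - s) V(s) x` has vanishing right
derivative, and the domain is dense. -/
theorem GeneratesC0Semigroup.unique (hU : GeneratesC0Semigroup A U)
    (hV : GeneratesC0Semigroup A V) {t : ℝ} (ht : 0 ≤ t) : U t = V t := by
  obtain ⟨M, hM⟩ := hU.exists_norm_le_Icc t
  have hdom : ∀ x y, (x, y) ∈ A.graph → U t x = V t x := by
    intro x y hxy
    have hcont : ContinuousOn (fun s => U (t - s) (V s x)) (Icc 0 t) := by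
      have h1 : ContinuousOn (fun p : E × ℝ => U p.2 p.1) (univ ×ˢ Icc 0 t) := by
        refine continuousOn_prod_of_continuousOn_lipschitzOnWith _ M.toNNReal
          (fun z _ => (hU.continuousOn z).mono Icc_subset_Ici_self) fun s hs => ?_
        refine ((U s).lipschitz.weaken ?_).lipschitzOnWith
        rw [← NNReal.coe_le_coe]
        exact (hM s hs).trans (Real.le_coe_toNNReal M)
      refine h1.comp (f := fun s => (V s x, t - s)) ?_ ?_
      · exact ((hV.continuousOn x).mono Icc_subset_Ici_self).prodMk
          (continuous_const.sub continuous_id).continuousOn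
      · exact fun s hs => ⟨mem_univ _, by simpa using hs.2, by simpa using hs.1⟩
    have hderiv : ∀ s ∈ Ico 0 t,
        HasDerivWithinAt (fun s => U (t - s) (V s x)) 0 (Ici s) s := by
      intro s hs
      rw [← hasDerivWithinAt_Ioi_iff_Ici, hasDerivWithinAt_iff_tendsto_slope' self_notMem_Ioi]
      have hg := hV.apply_mem_graph hxy hs.1
      have h1 := ((hV.mem_graph_iff _ _).1 hg).sub ((hU.mem_graph_iff _ _).1 hg)
      rw [sub_self] at h1
      have h2 : Tendsto (fun r : ℝ => r - s) (𝓝[>] s) (𝓝[>] 0) := by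
        refine tendsto_nhdsWithin_iff.2 ⟨?_, ?_⟩
        · have : Tendsto (fun r : ℝ => r - s) (𝓝 s) (𝓝 (s - s)) :=
            (continuous_sub_right s).tendsto s
          rw [sub_self] at this
          exact this.mono_left nhdsWithin_le_nhds
        · filter_upwards [self_mem_nhdsWithin] with r hr
          exact mem_Ioi.2 (sub_pos.2 (mem_Ioi.1 hr))
      have h3 := (h1.comp h2).norm.const_mul M
      rw [norm_zero, mul_zero] at h3
      refine squeeze_zero_norm' ?_ h3
      filter_upwards [self_mem_nhdsWithin, Ioo_mem_nhdsGT hs.2] with r hr hr2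
      have hrs : 0 ≤ r - s := sub_nonneg.2 (le_of_lt hr)
      have htr : 0 ≤ t - r := sub_nonneg.2 hr2.2.le
      have e1 : V r x = V (r - s) (V s x) := by rw [← hV.apply_add hrs hs.1, sub_add_cancel]
      have e2 : U (t - s) (V s x) = U (t - r) (U (r - s) (V s x)) := by
        rw [← hU.apply_add htr hrs, sub_add_sub_cancel]
      have e3 : slope (fun s => U (t - s) (V s x)) s r =
          U (t - r) (((r - s : ℝ) : 𝕜)⁻¹ • (V (r - s) (V s x) - V s x) -
            ((r - s : ℝ) : 𝕜)⁻¹ • (U (r - s) (V s x) - V s x)) := by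
        rw [slope_def_module, ← smul_sub, sub_sub_sub_cancel_right, map_smul, map_sub, e1, e2,
          RCLike.ofReal_inv_smul_eq]
      rw [e3]
      exact ContinuousLinearMap.le_of_opNorm_le _ (hM _ ⟨htr, by linarith [hs.1]⟩) _
    have h := constant_of_has_deriv_right_zero hcont hderiv t ⟨ht, le_rfl⟩
    simpa [hU.map_zero, hV.map_zero] using h.symm
  ext x
  -- `x` is the limit of the averages of its orbit, which lie in the domain
  have h1 := (hV.continuous_orbit x).tendsto_inv_smul_integral 0
  simp only [max_self, hV.map_zero, ContinuousLinearMap.id_apply, zero_add] at h1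
  have hcl : IsClosed {z | U t z = V t z} := isClosed_eq (U t).continuous (V t).continuous
  refine hcl.mem_of_tendsto h1 ?_
  filter_upwards [self_mem_nhdsWithin] with h hh
  have h2 := hdom _ _ (hV.integral_mem_graph x (le_of_lt hh))
  rw [← RCLike.ofReal_inv_smul_eq 𝕜, map_smul, map_smul, h2]

end Generator

/-! ### The inverse of the generator of a stable semigroup -/

section Inverse

open MeasureTheory

variable {𝕜 Y : Type*} [RCLike 𝕜] [NormedAddCommGroup Y] [NormedSpace 𝕜 Y]
  {D : Y →ₗ.[𝕜] Y} {T : ℝ → Y →L[𝕜] Y}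

theorem GeneratesC0Semigroup.integrableOn_Ioi (hD : GeneratesC0Semigroup D T)
    (hT : UniformlyExpStable T) (y : Y) : IntegrableOn (fun u => T u y) (Ioi 0) :=
  integrableOn_semigroup_apply (φ := fun _ => y) hD.continuousOn hT stronglyMeasurable_const
    fun _ => le_rfl

variable [CompleteSpace Y] [NormedSpace ℝ Y] [IsScalarTower ℝ 𝕜 Y]

/-- The whole orbit integral `∫₀^∞ T(u) y du` lies in the domain of the generator, which maps it
to `-y`. -/
theorem GeneratesC0Semigroup.integral_Ioi_mem_graph (hD : GeneratesC0Semigroup D T)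
    (hT : UniformlyExpStable T) (y : Y) : (∫ u in Ioi (0 : ℝ), T u y, -y) ∈ D.graph := by
  have hi := hD.integrableOn_Ioi hT y
  rw [hD.mem_graph_iff]
  have h1 := ((hD.continuous_orbit y).tendsto_inv_smul_integral 0).neg
  simp only [max_self, hD.map_zero, ContinuousLinearMap.id_apply, zero_add] at h1
  refine h1.congr' ?_
  filter_upwards [self_mem_nhdsWithin] with h hh
  have hh' : (0 : ℝ) ≤ h := le_of_lt hh
  have h2 : T h (∫ u in Ioi (0 : ℝ), T u y) = ∫ u in Ioi h, T u y := by
    rw [← ContinuousLinearMap.integral_comp_comm _ hi,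
      ← (measurePreserving_add_right volume h).setIntegral_preimage_emb
        (measurableEmbedding_addRight h) _ (Ioi h), preimage_add_const_Ioi, sub_self]
    refine setIntegral_congr_fun measurableSet_Ioi fun u hu => ?_
    rw [← hD.apply_add hh' (le_of_lt hu), add_comm]
  have h3 : ∫ u in (0 : ℝ)..h, T (max u 0) y = ∫ u in (0 : ℝ)..h, T u y := by
    refine intervalIntegral.integral_congr fun u hu => ?_
    rw [uIcc_of_le hh'] at hu
    rw [max_eq_left hu.1]
  rw [h2, h3, RCLike.ofReal_inv_smul_eq, ← intervalIntegral.integral_Ioi_sub_Ioi hi hh',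
    ← smul_neg, neg_sub]

/-- The bounded operator `y ↦ ∫₀^∞ T(u) y du` exists, and its negative inverts the generator. -/
theorem GeneratesC0Semigroup.exists_isBoundedInverse (hD : GeneratesC0Semigroup D T)
    (hT : UniformlyExpStable T) :
    ∃ G : Y →L[𝕜] Y, IsBoundedInverse D G ∧ ∀ y, ∫ u in Ioi (0 : ℝ), T u y = -G y := by
  obtain ⟨c, -, hc⟩ := hT.exists_norm_integral_le
  have hadd : ∀ y z, ∫ u in Ioi (0 : ℝ), T u (y + z) =
      (∫ u in Ioi (0 : ℝ), T u y) + ∫ u in Ioi (0 : ℝ), T u z := fun y z => by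
    simp only [_root_.map_add]
    exact integral_add (hD.integrableOn_Ioi hT y) (hD.integrableOn_Ioi hT z)
  have hsmul : ∀ (a : 𝕜) (y), ∫ u in Ioi (0 : ℝ), T u (a • y) =
      a • ∫ u in Ioi (0 : ℝ), T u y := fun a y => by
    simp only [map_smul]
    exact integral_smul a _
  let J : Y →L[𝕜] Y := LinearMap.mkContinuous
    { toFun := fun y => ∫ u in Ioi (0 : ℝ), T u y
      map_add' := hadd
      map_smul' := hsmul } c
    fun y => hc (fun _ => y) ‖y‖ fun _ => le_rfl
  have hJ : ∀ y, (J y, -y) ∈ D.graph := hD.integral_Ioi_mem_graph hT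
  refine ⟨-J, ⟨fun y => ?_, fun y => ?_⟩, fun y => ?_⟩
  · obtain ⟨z, hz1, hz2⟩ := (LinearPMap.mem_graph_iff D).1 (D.graph.neg_mem (hJ y))
    simp only [Prod.fst_neg, Prod.snd_neg, neg_neg] at hz1 hz2
    have hz : (-J) y = z := by rw [hz1]; rfl
    refine ⟨hz ▸ z.2, ?_⟩
    exact (congrArg D (Subtype.ext hz)).trans hz2
  · -- `J` commutes with the difference quotients of the semigroup
    have h1 := (J.continuous.tendsto _).comp ((hD.mem_graph_iff _ _).1 (D.mem_graph y))
    have h2 := (hD.mem_graph_iff _ _).1 (hJ y)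
    have h3 : J (D y) = -y := by
      refine tendsto_nhds_unique_of_eventuallyEq h1 h2 ?_
      filter_upwards [self_mem_nhdsWithin] with h hh
      have h4 : J (T h y) = T h (J y) := by
        change ∫ u in Ioi (0 : ℝ), T u (T h y) = T h (∫ u in Ioi (0 : ℝ), T u y)
        rw [← ContinuousLinearMap.integral_comp_comm _ (hD.integrableOn_Ioi hT _)]
        refine setIntegral_congr_fun measurableSet_Ioi fun u hu => ?_
        rw [← hD.apply_add (le_of_lt hu) (le_of_lt hh), add_comm,
          hD.apply_add (le_of_lt hh) (le_of_lt hu)]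
      simp only [Function.comp_apply, map_smul, map_sub, h4]
    rw [neg_apply, h3, neg_neg]
  · rw [neg_apply, neg_neg]
    rfl

end Inverse

/-! ### The semigroup generated by the operator matrix -/

section Matrix

open MeasureTheory

variable {𝕜 X Y : Type*} [RCLike 𝕜] [NormedAddCommGroup X] [NormedSpace 𝕜 X]
  [NormedAddCommGroup Y] [NormedSpace 𝕜 Y]
  {A : X →ₗ.[𝕜] X} {C : X →L[𝕜] Y} {D : Y →ₗ.[𝕜] Y} {S : ℝ → X →L[𝕜] X} {T : ℝ → Y →L[𝕜] Y}

theorem mem_graph_operatorMatrix_zero_iff {x x' : X} {y y' : Y} :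
    ((x, y), (x', y')) ∈ (operatorMatrix A 0 C D).graph ↔
      (x, x') ∈ A.graph ∧ (y, y' - C x) ∈ D.graph := by
  simp only [LinearPMap.mem_graph_iff]
  constructor
  · rintro ⟨⟨⟨u, v⟩, hu, hv⟩, h1, h2⟩
    obtain ⟨rfl, rfl⟩ := Prod.mk.inj h1
    have h3 : (A ⟨u, hu⟩ + (0 : Y →L[𝕜] X) v, C u + D ⟨v, hv⟩) = (x', y') := h2
    obtain ⟨rfl, rfl⟩ := Prod.mk.inj h3
    exact ⟨⟨⟨u, hu⟩, rfl, by simp⟩, ⟨⟨v, hv⟩, rfl, by simp⟩⟩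
  · rintro ⟨⟨⟨u, hu⟩, rfl, rfl⟩, ⟨⟨v, hv⟩, rfl, hy⟩⟩
    refine ⟨⟨(u, v), hu, hv⟩, rfl, ?_⟩
    change (A ⟨u, hu⟩ + (0 : Y →L[𝕜] X) v, C u + D ⟨v, hv⟩) = (_, y')
    rw [hy]
    simp

/-- The integrand of `R(t) x`, extended to all real values of the two times by clamping, is jointly
continuous. -/
theorem continuous_convR_integrand (hA : GeneratesC0Semigroup A S)
    (hD : GeneratesC0Semigroup D T) (hT : UniformlyExpStable T) (x : X) :
    Continuous fun p : ℝ × ℝ => T (max p.1 0) (C (S (max p.2 0) x)) := by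
  obtain ⟨M, hM⟩ := hT.exists_norm_le
  exact (continuous_apply_max_zero hD.continuousOn hM).comp
    (continuous_fst.prodMk (C.continuous.comp ((hA.continuous_orbit x).comp continuous_snd)))

theorem intervalIntegrable_convR_integrand (hA : GeneratesC0Semigroup A S)
    (hD : GeneratesC0Semigroup D T) (hT : UniformlyExpStable T) (t : ℝ) (x : X) (a b : ℝ) :
    IntervalIntegrable (fun s => T (max (t - s) 0) (C (S (max s 0) x))) volume a b :=
  ((continuous_convR_integrand hA hD hT x).comp
    ((continuous_const.sub continuous_id).prodMk continuous_id)).intervalIntegrable a b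

variable [NormedSpace ℝ Y]

theorem convR_eq_integral_max {t : ℝ} (ht : 0 ≤ t) (x : X) :
    convR S C T t x = ∫ s in (0 : ℝ)..t, T (max (t - s) 0) (C (S (max s 0) x)) := by
  refine intervalIntegral.integral_congr fun s hs => ?_
  rw [uIcc_of_le ht] at hs
  rw [max_eq_left hs.1, max_eq_left (sub_nonneg.2 hs.2)]

/-- The cocycle identity of `R`, which makes the matrix family a semigroup. -/
theorem convR_add [CompleteSpace Y] (hA : GeneratesC0Semigroup A S)
    (hD : GeneratesC0Semigroup D T) (hT : UniformlyExpStable T) {s t : ℝ} (hs : 0 ≤ s)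
    (ht : 0 ≤ t) (x : X) :
    convR S C T (s + t) x = convR S C T s (S t x) + T s (convR S C T t x) := by
  have hi := intervalIntegrable_convR_integrand (C := C) hA hD hT
  rw [convR_eq_integral_max (add_nonneg hs ht),
    ← intervalIntegral.integral_add_adjacent_intervals (hi _ x 0 t) (hi _ x t (s + t)), add_comm]
  congr 1
  · have h := intervalIntegral.integral_comp_add_right (a := 0) (b := s)
      (fun r => T (max (s + t - r) 0) (C (S (max r 0) x))) t
    rw [zero_add] at h
    rw [← h]
    refine intervalIntegral.integral_congr fun r hr => ?_
    rw [uIcc_of_le hs] at hr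
    rw [max_eq_left (add_nonneg hr.1 ht), add_sub_add_right_eq_sub,
      max_eq_left (sub_nonneg.2 hr.2), hA.apply_add hr.1 ht]
  · rw [convR_eq_integral_max ht, ← ContinuousLinearMap.intervalIntegral_comp_comm _ (hi _ _ _ _)]
    refine intervalIntegral.integral_congr fun r hr => ?_
    rw [uIcc_of_le ht] at hr
    rw [add_sub_assoc, max_eq_left (sub_nonneg.2 hr.2),
      max_eq_left (add_nonneg hs (sub_nonneg.2 hr.2)), hD.apply_add hs (sub_nonneg.2 hr.2)]

/-- The right derivative of `R(·) x` at `0` is `C x`. -/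
theorem tendsto_inv_smul_convR [CompleteSpace Y] (hA : GeneratesC0Semigroup A S)
    (hD : GeneratesC0Semigroup D T) (hT : UniformlyExpStable T) (x : X) :
    Tendsto (fun h : ℝ => h⁻¹ • convR S C T h x) (𝓝[>] 0) (𝓝 (C x)) := by
  -- rescaling to the unit interval turns the mean into an integral continuous in the parameter
  have h1 : Continuous fun h : ℝ =>
      ∫ r in (0 : ℝ)..1, T (max (h - h * r) 0) (C (S (max (h * r) 0) x)) := by
    refine intervalIntegral.continuous_parametric_intervalIntegral_of_continuous' ?_ 0 1
    exact (continuous_convR_integrand (C := C) hA hD hT x).comp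
      (((continuous_fst.sub (continuous_fst.mul continuous_snd))).prodMk
        (continuous_fst.mul continuous_snd))
  have h2 := (h1.tendsto 0).mono_left (nhdsWithin_le_nhds (s := Ioi 0))
  simp only [zero_mul, sub_zero, max_self, hA.map_zero, hD.map_zero,
    ContinuousLinearMap.id_apply, intervalIntegral.integral_const, one_smul] at h2
  refine h2.congr' ?_
  filter_upwards [self_mem_nhdsWithin] with h hh
  have h3 := intervalIntegral.smul_integral_comp_mul_left (a := 0) (b := 1)
    (fun s => T (max (h - s) 0) (C (S (max s 0) x))) h
  rw [mul_zero, mul_one] at h3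
  rw [convR_eq_integral_max (le_of_lt hh), ← h3, inv_smul_smul₀ (ne_of_gt hh)]

/-- If both diagonal semigroups decay exponentially then so does `R`; the polynomial factor `t` of
the convolution of two exponentials costs half of the smaller decay rate. -/
theorem exists_norm_convR_le (hS : UniformlyExpStable S) (hT : UniformlyExpStable T)
    (C : X →L[𝕜] Y) : ∃ N β : ℝ, 0 ≤ N ∧ 0 < β ∧ ∀ t, 0 ≤ t → ∀ x,
      ‖convR S C T t x‖ ≤ N * Real.exp (-β * t) * ‖x‖ := by
  obtain ⟨M, ω, hM, hω, hTb⟩ := hT.exists_bound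
  obtain ⟨M', ω', hM', hω', hSb⟩ := hS.exists_bound
  set α := min ω ω'
  have hα0 : 0 < α := lt_min hω hω'
  refine ⟨M * ‖C‖ * M' * (2 / α), α / 2, by positivity, by positivity, fun t ht x => ?_⟩
  have h1 : ‖convR S C T t x‖ ≤ M * ‖C‖ * M' * Real.exp (-α * t) * ‖x‖ * |t - 0| := by
    refine intervalIntegral.norm_integral_le_of_norm_le_const fun s hs => ?_
    rw [uIoc_of_le ht] at hs
    have hs0 := hs.1.le
    have hts : 0 ≤ t - s := sub_nonneg.2 hs.2
    calc ‖T (t - s) (C (S s x))‖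
        ≤ (M * Real.exp (-ω * (t - s))) * (‖C‖ * (M' * Real.exp (-ω' * s) * ‖x‖)) :=
          ContinuousLinearMap.le_of_opNorm_le_of_le _ (hTb _ hts)
            (C.le_opNorm_of_le (ContinuousLinearMap.le_of_opNorm_le _ (hSb s hs0) x))
      _ = M * ‖C‖ * M' * (Real.exp (-ω * (t - s)) * Real.exp (-ω' * s)) * ‖x‖ := by ring
      _ ≤ M * ‖C‖ * M' * Real.exp (-α * t) * ‖x‖ := by
          rw [← Real.exp_add]
          gcongr
          nlinarith [mul_le_mul_of_nonneg_right (min_le_left ω ω') hts,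
            mul_le_mul_of_nonneg_right (min_le_right ω ω') hs0]
  have h2 : t * Real.exp (-α * t) ≤ 2 / α * Real.exp (-(α / 2) * t) := by
    have h3 : α / 2 * t ≤ Real.exp (α / 2 * t) := by linarith [Real.add_one_le_exp (α / 2 * t)]
    have h4 : t ≤ 2 / α * Real.exp (α / 2 * t) := by
      rw [div_mul_eq_mul_div, le_div_iff₀ hα0]
      linarith
    calc t * Real.exp (-α * t) ≤ 2 / α * Real.exp (α / 2 * t) * Real.exp (-α * t) := by gcongr
      _ = 2 / α * Real.exp (-(α / 2) * t) := by
        rw [mul_assoc, ← Real.exp_add]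
        ring_nf
  rw [sub_zero, abs_of_nonneg ht] at h1
  calc ‖convR S C T t x‖ ≤ M * ‖C‖ * M' * ‖x‖ * (t * Real.exp (-α * t)) := by linarith
    _ ≤ M * ‖C‖ * M' * ‖x‖ * (2 / α * Real.exp (-(α / 2) * t)) := by gcongr
    _ = _ := by ring

/-- The operators `R(t)` assemble to an exponentially decaying family of bounded operators. -/
theorem exists_convR_clm [IsScalarTower ℝ 𝕜 Y] (hA : GeneratesC0Semigroup A S)
    (hD : GeneratesC0Semigroup D T) (hS : UniformlyExpStable S) (hT : UniformlyExpStable T)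
    (C : X →L[𝕜] Y) : ∃ R : ℝ → X →L[𝕜] Y, (∀ t, 0 ≤ t → ∀ x, R t x = convR S C T t x) ∧
      ∃ N β : ℝ, 0 ≤ N ∧ 0 < β ∧ ∀ t, 0 ≤ t → ‖R t‖ ≤ N * Real.exp (-β * t) := by
  obtain ⟨N, β, hN, hβ, h⟩ := exists_norm_convR_le hS hT C
  have hi := intervalIntegrable_convR_integrand (C := C) hA hD hT
  have hex : ∀ t : ℝ, ∃ R : X →L[𝕜] Y, 0 ≤ t →
      (∀ x, R x = convR S C T t x) ∧ ‖R‖ ≤ N * Real.exp (-β * t) := by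
    intro t
    by_cases ht : 0 ≤ t
    · refine ⟨LinearMap.mkContinuous
        { toFun := fun x => convR S C T t x
          map_add' := fun x y => by
            simp only [convR_eq_integral_max ht, map_add]
            exact intervalIntegral.integral_add (hi _ _ _ _) (hi _ _ _ _)
          map_smul' := fun a x => by
            simp only [convR_eq_integral_max ht, map_smul, RingHom.id_apply]
            exact intervalIntegral.integral_smul a _ } _ (h t ht),
        fun _ => ⟨fun _ => rfl, LinearMap.mkContinuous_norm_le _ (by positivity) _⟩⟩
    · exact ⟨0, fun h' => absurd h' ht⟩
  choose R hR using hex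
  exact ⟨R, fun t ht => (hR t ht).1, N, β, hN, hβ, fun t ht => (hR t ht).2⟩

/-- The lower triangular family with diagonal `S`, `T` and corner `R` is a stable semigroup, and
the operator matrix generates it. -/
theorem exists_generatesC0Semigroup_operatorMatrix [CompleteSpace Y] [IsScalarTower ℝ 𝕜 Y]
    (hA : GeneratesC0Semigroup A S) (hD : GeneratesC0Semigroup D T)
    (hS : UniformlyExpStable S) (hT : UniformlyExpStable T) (C : X →L[𝕜] Y) :
    ∃ V : ℝ → (X × Y) →L[𝕜] (X × Y),
      GeneratesC0Semigroup (operatorMatrix A 0 C D) V ∧ UniformlyExpStable V := by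
  obtain ⟨R, hR, N, β, hN, hβ, hRb⟩ := exists_convR_clm hA hD hS hT C
  obtain ⟨M, ω, hM, hω, hTb⟩ := hT.exists_bound
  obtain ⟨M', ω', hM', hω', hSb⟩ := hS.exists_bound
  obtain ⟨K, hK⟩ := hS.exists_norm_le
  let V : ℝ → (X × Y) →L[𝕜] (X × Y) := fun t =>
    ((S t).comp (ContinuousLinearMap.fst 𝕜 X Y)).prod
      ((R t).comp (ContinuousLinearMap.fst 𝕜 X Y) + (T t).comp (ContinuousLinearMap.snd 𝕜 X Y))
  have hVa : ∀ t x y, V t (x, y) = (S t x, R t x + T t y) := fun _ _ _ => rfl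
  refine ⟨V, ⟨?_, ?_, ?_, ?_⟩, ?_⟩
  · refine ContinuousLinearMap.ext fun ⟨x, y⟩ => ?_
    rw [hVa, hR 0 le_rfl, hA.map_zero, hD.map_zero]
    simp [convR]
  · refine fun s t hs ht => ContinuousLinearMap.ext fun ⟨x, y⟩ => ?_
    rw [ContinuousLinearMap.comp_apply, hVa, hVa, hVa, hR _ (add_nonneg hs ht), hR s hs, hR t ht,
      convR_add hA hD hT hs ht, hA.apply_add hs ht, hD.apply_add hs ht, map_add, add_assoc]
  · rintro ⟨x, y⟩
    have h1 : ContinuousOn (fun t => R t x) (Ici 0) :=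
      (continuousOn_convR hD.continuousOn hT (hA.continuousOn x) (K := K * ‖x‖)
        fun t ht => ContinuousLinearMap.le_of_opNorm_le _ (hK t ht) x).congr
        fun t ht => hR t ht x
    exact (hA.continuousOn x).prodMk (h1.add (hD.continuousOn y))
  · rintro ⟨x, y⟩ ⟨x', y'⟩
    rw [mem_graph_operatorMatrix_zero_iff, hA.mem_graph_iff, hD.mem_graph_iff,
      Prod.tendsto_iff]
    refine and_congr Iff.rfl ?_
    have h1 := tendsto_inv_smul_convR (C := C) hA hD hT x
    have h2 : (fun h : ℝ => (((h : 𝕜)⁻¹) • (V h (x, y) - (x, y))).2) =ᶠ[𝓝[>] 0]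
        fun h => ((h : 𝕜)⁻¹) • (T h y - y) + h⁻¹ • convR S C T h x := by
      filter_upwards [self_mem_nhdsWithin] with h hh
      rw [hVa, hR h (le_of_lt hh), ← RCLike.ofReal_inv_smul_eq 𝕜, ← smul_add]
      change ((h : 𝕜)⁻¹) • (convR S C T h x + T h y - y) = _
      congr 1
      abel
    rw [tendsto_congr' h2]
    constructor
    · intro h3
      simpa using h3.add h1
    · intro h3
      simpa using h3.sub h1
  · refine ⟨M' + (N + M), min ω' (min β ω), lt_min hω' (lt_min hβ hω), fun t ht => ?_⟩
    set γ := min ω' (min β ω)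
    have hexp : ∀ δ, γ ≤ δ → Real.exp (-δ * t) ≤ Real.exp (-γ * t) := fun δ hδ =>
      Real.exp_le_exp.2 (by nlinarith)
    have e1 := hexp ω' (min_le_left _ _)
    have e2 := hexp β ((min_le_right _ _).trans (min_le_left _ _))
    have e3 := hexp ω ((min_le_right _ _).trans (min_le_right _ _))
    refine ContinuousLinearMap.opNorm_le_bound _ (by positivity) fun ⟨x, y⟩ => ?_
    have hx : ‖x‖ ≤ ‖(x, y)‖ := norm_fst_le (x, y)
    have hy : ‖y‖ ≤ ‖(x, y)‖ := norm_snd_le (x, y)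
    set z := ‖(x, y)‖
    have b1 : ‖S t x‖ ≤ M' * Real.exp (-γ * t) * z :=
      ContinuousLinearMap.le_of_opNorm_le_of_le _
        ((hSb t ht).trans (mul_le_mul_of_nonneg_left e1 hM')) hx
    have b2 : ‖R t x‖ ≤ N * Real.exp (-γ * t) * z :=
      ContinuousLinearMap.le_of_opNorm_le_of_le _
        ((hRb t ht).trans (mul_le_mul_of_nonneg_left e2 hN)) hx
    have b3 : ‖T t y‖ ≤ M * Real.exp (-γ * t) * z :=
      ContinuousLinearMap.le_of_opNorm_le_of_le _
        ((hTb t ht).trans (mul_le_mul_of_nonneg_left e3 hM)) hy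
    have b4 := norm_add_le (R t x) (T t y)
    have n1 := norm_nonneg (S t x)
    have n2 := norm_nonneg (R t x)
    have n3 := norm_nonneg (T t y)
    rw [hVa, Prod.norm_mk]
    exact max_le (by nlinarith) (by nlinarith)

end Matrix

/-! ### Stability of the lower triangular system -/

theorem mainTheorem4 {𝕜 X Y : Type*} [RCLike 𝕜]
    [NormedAddCommGroup X] [NormedSpace 𝕜 X] [CompleteSpace X]
    [NormedAddCommGroup Y] [NormedSpace 𝕜 Y] [CompleteSpace Y]
    [NormedSpace ℝ Y] [IsScalarTower ℝ 𝕜 Y]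
    (A : X →ₗ.[𝕜] X) (C : X →L[𝕜] Y) (D : Y →ₗ.[𝕜] Y)
    (S : ℝ → X →L[𝕜] X) (T : ℝ → Y →L[𝕜] Y)
    (hA : GeneratesC0Semigroup A S) (hD : GeneratesC0Semigroup D T)
    (hT : UniformlyExpStable T) :
    -- (1) bounded orbits of the first semigroup
    (∀ x : X, BoundedOrbit (fun t => S t x) → BoundedOrbit (fun t => convR S C T t x)) ∧
    -- (2) asymptotically almost periodic orbits
    (∀ x : X, AsymptoticallyAlmostPeriodic (fun t => S t x) →
      AsymptoticallyAlmostPeriodic (fun t => convR S C T t x)) ∧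
    -- (3) convergent orbits; `D` is invertible
    (∃ Dinv : Y →L[𝕜] Y, IsBoundedInverse D Dinv ∧
      ∀ x xlim : X, Tendsto (fun t => S t x) atTop (𝓝 xlim) →
        Tendsto (fun t => convR S C T t x) atTop (𝓝 (-(Dinv (C xlim))))) ∧
    -- (4) the semigroup generated by the operator matrix
    (UniformlyExpStable S →
      (∃ U : ℝ → (X × Y) →L[𝕜] (X × Y), GeneratesC0Semigroup (operatorMatrix A 0 C D) U) ∧
      ∀ U : ℝ → (X × Y) →L[𝕜] (X × Y),
        GeneratesC0Semigroup (operatorMatrix A 0 C D) U → UniformlyExpStable U) := by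
  refine ⟨fun x hx => boundedOrbit_convR hT hx,
    fun x hx => asymptoticallyAlmostPeriodic_convR hD.continuousOn hT hx, ?_, fun hS => ?_⟩
  · obtain ⟨G, hG, hGi⟩ := hD.exists_isBoundedInverse hT
    refine ⟨G, hG, fun x xlim hx => ?_⟩
    rw [← hGi]
    exact tendsto_convR hD.continuousOn hT (hA.continuousOn x) hx
  · obtain ⟨V, hV, M, ω, hω, hVb⟩ := exists_generatesC0Semigroup_operatorMatrix hA hD hS hT C
    refine ⟨⟨V, hV⟩, fun U hU => ⟨M, ω, hω, fun t ht => ?_⟩⟩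
    -- uniqueness integrates orbits in `X × Y`, which needs a real structure on `X`
    let : NormedSpace ℝ X := NormedSpace.restrictScalars ℝ 𝕜 X
    have : IsScalarTower ℝ 𝕜 X := IsScalarTower.restrictScalars ℝ 𝕜 X
    rw [hU.unique hV ht]
    exact hVb t ht
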